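/- Let $K$ be a field complete for an ultrametric norm $|\cdot|$, with infinite residue field and with value group $|K^*|=\{|z| : z\in K^*\}\subset\mathbb{R}_{>0}$ not discrete. Let $\mathbb{P}^1_K=K\sqcup\{\infty\}$ be the projective line. A ball of $K$ is a set $\{z : |z-a|<r\}$ or $\{z : |z-a|\le r\}$ with $a\in K$, $r>0$; it is called open, resp. closed, if $r\in|K^*|$, and irrational if $r\notin|K^*|$ (the two sets then coincide). An open (resp. closed, irrational) ball of $\mathbb{P}^1_K$ is an open (resp. closed, irrational) ball of $K$ or the complement in $\mathbb{P}^1_K$ of a closed (resp. open, irrational) ball of $K$. An open affinoid is a finite (possibly empty) intersection of open balls of $\mathbb{P}^1_K$. Give $\mathbb{P}^1_K$ the uniform structure whose entourages are the sets containing $V(C)=\bigcup_{Y\in C}Y\times Y$ for some finite cover $C$ of $\mathbb{P}^1_K$ by open affinoids, and let $\mathsf{A}^1_K$ (the Berkovich projective line) be its separated completion: its points are the minimal Cauchy filters on $\mathbb{P}^1_K$, and the sets $\hat V(\mathcal S)=\{\mathcal S' : \mathcal S\text{ and }\mathcal S'\text{ have a common member }Y\text{ with }Y\times Y\subset V\}$,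 $V$ an entourage, form a neighbourhood base at $\mathcal S$. For $Y\subset\mathbb{P}^1_K$ put $\hat Y=\{\mathcal S\in\mathsf{A}^1_K : Y\in\mathcal S\}$. The convergent minimal Cauchy filters are identified with the points of $\mathbb{P}^1_K$. For a non-convergent $\mathcal S$, let $B_{\mathcal S}$ be the intersection of all balls of $K$ that belong to $\mathcal S$; the point $\mathcal S$ is rational if $B_{\mathcal S}$ is a closed ball of $K$, irrational if $B_{\mathcal S}$ is an irrational ball of $K$, and singular if $B_{\mathcal S}=\emptyset$. For $\mathcal S$ rational or irrational, let $\pi(\mathcal S)$ be the set of all open or irrational balls $B$ of $\mathbb{P}^1_K$ such that, $D$ denoting the one of $B$ and $\mathbb{P}^1_K\setminus B$ that is contained in $K$, the closed or irrational ball of $K$ containing $D$ and of the same diameter as $D$ is $B_{\mathcal S}$. Then, for every point $\mathcal S$ of $\mathsf{A}^1_K$: 1. If $\mathcal S$ is rational or irrational, the connected components of $\mathsf{A}^1_K\setminus\{\mathcal S\}$ are exactly the sets $\hat B$ with $B\in\pi(\mathcal S)$. 2. If $\mathcal S$ is singular or belongs to $\mathbb{P}^1_K$, then $\mathsf{A}^1_K\setminus\{\mathcal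 S\}$ is connected. -/

import Mathlib

namespace BerkovichLine

section Balls

variable (K : Type*) [NormedField K]

/-- The value group `|K^*|`, as a set of (positive) real numbers. -/
def valueGroup : Set ℝ := {r | ∃ z : K, z ≠ 0 ∧ ‖z‖ = r}

/-- The projective line: the set of lines through the origin of `K × K`. -/
abbrev P1 : Type _ := Projectivization K (K × K)

variable {K}

/-- The embedding `x ↦ [x : 1]` of `K` in the projective line. Its image is the complement of
`∞ = [1 : 0]`. -/
def ofField (x : K) : P1 K :=
  Projectivization.mk K ((x, 1) : K × K) (fun h => one_ne_zero (congrArg Prod.snd h))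

/-- Open balls of `K`: the radius is in the value group. -/
def IsOpenBallK (B : Set K) : Prop :=
  ∃ a : K, ∃ r ∈ valueGroup K, B = {z | ‖z - a‖ < r}

/-- Closed balls of `K`: the radius is in the value group. -/
def IsClosedBallK (B : Set K) : Prop :=
  ∃ a : K, ∃ r ∈ valueGroup K, B = {z | ‖z - a‖ ≤ r}

/-- Irrational balls of `K`: the radius is positive and not in the value group (so that `<` and `≤`
give the same set). -/
def IsIrrationalBallK (B : Set K) : Prop :=
  ∃ a : K, ∃ r : ℝ, 0 < r ∧ r ∉ valueGroup K ∧ B = {z | ‖z - a‖ < r}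

/-- Balls of `K`, of any of the three kinds. -/
def IsBallK (B : Set K) : Prop :=
  IsOpenBallK B ∨ IsClosedBallK B ∨ IsIrrationalBallK B

/-- Open balls of the projective line: open balls of `K`, and complements of closed balls
of `K`. -/
def IsOpenBall (B : Set (P1 K)) : Prop :=
  (∃ D : Set K, IsOpenBallK D ∧ B = ofField '' D) ∨
    (∃ D : Set K, IsClosedBallK D ∧ B = (ofField '' D)ᶜ)

/-- Irrational balls of the projective line: irrational balls of `K` and their complements. -/
def IsIrrationalBall (B : Set (P1 K)) : Prop :=
  ∃ D : Set K, IsIrrationalBallK D ∧ (B = ofField '' D ∨ B = (ofField '' D)ᶜ)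

/-- Open affinoids: finite intersections of open balls of the projective line (the whole projective
line is the empty intersection). -/
def IsOpenAffinoid (Y : Set (P1 K)) : Prop :=
  ∃ s : Set (Set (P1 K)), s.Finite ∧ (∀ B ∈ s, IsOpenBall B) ∧ Y = ⋂₀ s

/-- Finite covers of the projective line by open affinoids. -/
def IsFiniteAffinoidCover (C : Set (Set (P1 K))) : Prop :=
  C.Finite ∧ (∀ Y ∈ C, IsOpenAffinoid Y) ∧ ⋃₀ C = Set.univ

/-- `V(C)`, the union of the squares `Y × Y` for `Y` in `C`. -/
def coverEntourage (C : Set (Set (P1 K))) : Set (P1 K × P1 K) := ⋃ Y ∈ C, Y ×ˢ Y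

theorem IsOpenAffinoid.inter {Y Y' : Set (P1 K)} (h : IsOpenAffinoid Y) (h' : IsOpenAffinoid Y') :
    IsOpenAffinoid (Y ∩ Y') := by
  obtain ⟨s, hs, hB, rfl⟩ := h
  obtain ⟨s', hs', hB', rfl⟩ := h'
  refine ⟨s ∪ s', hs.union hs', ?_, (Set.sInter_union s s').symm⟩
  rintro B (hB1 | hB1)
  exacts [hB B hB1, hB' B hB1]

theorem isFiniteAffinoidCover_univ : IsFiniteAffinoidCover ({Set.univ} : Set (Set (P1 K))) := by
  refine ⟨Set.finite_singleton _, ?_, Set.sUnion_singleton _⟩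
  rintro Y rfl
  exact ⟨∅, Set.finite_empty, fun B hB => hB.elim, Set.sInter_empty.symm⟩

theorem IsFiniteAffinoidCover.inter {C C' : Set (Set (P1 K))} (h : IsFiniteAffinoidCover C)
    (h' : IsFiniteAffinoidCover C') :
    IsFiniteAffinoidCover (Set.image2 (fun Y Y' => Y ∩ Y') C C') := by
  refine ⟨h.1.image2 _ h'.1, ?_, ?_⟩
  · rintro _ ⟨Y, hY, Y', hY', rfl⟩
    exact (h.2.1 Y hY).inter (h'.2.1 Y' hY')
  · refine Set.eq_univ_of_forall fun x => ?_
    obtain ⟨Y, hY, hx⟩ : x ∈ ⋃₀ C := h.2.2 ▸ Set.mem_univ x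
    obtain ⟨Y', hY', hx'⟩ : x ∈ ⋃₀ C' := h'.2.2 ▸ Set.mem_univ x
    exact ⟨Y ∩ Y', ⟨Y, hY, Y', hY', rfl⟩, hx, hx'⟩

variable (K) in
/-- The uniform structure of finite covers by open affinoids: an entourage is a set of pairs that
contains `V(C)` for some finite cover `C` by open affinoids. -/
def entourages : Filter (P1 K × P1 K) where
  sets := {V | ∃ C, IsFiniteAffinoidCover C ∧ coverEntourage C ⊆ V}
  univ_sets := ⟨_, isFiniteAffinoidCover_univ, Set.subset_univ _⟩
  sets_of_superset := fun ⟨C, hC, h⟩ hVW => ⟨C, hC, h.trans hVW⟩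
  inter_sets := by
    rintro V V' ⟨C, hC, h⟩ ⟨C', hC', h'⟩
    refine ⟨_, hC.inter hC', ?_⟩
    intro p hp
    simp only [coverEntourage, Set.mem_iUnion] at hp
    obtain ⟨_, ⟨Y, hY, Y', hY', rfl⟩, hp1, hp2⟩ := hp
    refine ⟨h ?_, h' ?_⟩
    · exact Set.mem_biUnion hY ⟨hp1.1, hp2.1⟩
    · exact Set.mem_biUnion hY' ⟨hp1.2, hp2.2⟩

/-- Cauchy filters: proper filters with a `V`-small member for every entourage `V`. -/
def IsCauchy (F : Filter (P1 K)) : Prop :=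
  F.NeBot ∧ ∀ V ∈ entourages K, ∃ Y ∈ F, Y ×ˢ Y ⊆ V

end Balls

/-- The points of the Berkovich projective line are the minimal Cauchy filters on the projective
line. Minimality is with respect to inclusion of collections of sets; Mathlib orders filters the
other way round (`F ≤ G` says that every member of `G` is one of `F`), whence `Maximal`. -/
def Ber (K : Type*) [NormedField K] : Type _ := {F : Filter (P1 K) // Maximal IsCauchy F}

variable {K : Type*} [NormedField K]

/-- The entourage `V̂` of the completion: pairs of points with a common `V`-small member. -/
def Ber.entourage (V : Set (P1 K × P1 K)) : Set (Ber K × Ber K) :=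
  {p | ∃ Y, Y ∈ p.1.1 ∧ Y ∈ p.2.1 ∧ Y ×ˢ Y ⊆ V}

/-- The topology of the separated completion: a set is open when, with each of its points `S`, it
contains the set `V̂(S)` for some entourage `V` of the projective line. -/
instance : TopologicalSpace (Ber K) where
  IsOpen O := ∀ S ∈ O, ∃ V ∈ entourages K, {T | (S, T) ∈ Ber.entourage V} ⊆ O
  isOpen_univ := fun _ _ => ⟨Set.univ, Filter.univ_mem, Set.subset_univ _⟩
  isOpen_inter := by
    rintro O O' h h' S ⟨hS, hS'⟩
    obtain ⟨V, hV, hVO⟩ := h S hS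
    obtain ⟨V', hV', hVO'⟩ := h' S hS'
    refine ⟨V ∩ V', Filter.inter_mem hV hV', ?_⟩
    rintro T ⟨Y, hY1, hY2, hY⟩
    exact ⟨hVO ⟨Y, hY1, hY2, hY.trans Set.inter_subset_left⟩,
      hVO' ⟨Y, hY1, hY2, hY.trans Set.inter_subset_right⟩⟩
  isOpen_sUnion := by
    rintro 𝒪 h S ⟨O, hO, hS⟩
    obtain ⟨V, hV, hVO⟩ := h O hO S hS
    exact ⟨V, hV, hVO.trans (Set.subset_sUnion_of_mem hO)⟩

namespace Ber

/-- `Ŷ`, the set of points that, as filters, have `Y` as a member. -/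
def hat (Y : Set (P1 K)) : Set (Ber K) := {S | Y ∈ S.1}

/-- The points of the projective line, inside its completion: the filters that converge to some
point `x`, i.e. contain every neighbourhood `V(x)` of `x`. -/
def IsClassical (S : Ber K) : Prop :=
  ∃ x : P1 K, ∀ V ∈ entourages K, {y | (x, y) ∈ V} ∈ S.1

/-- The intersection of all the balls of `K` that are members of the filter `S`. -/
def core (S : Ber K) : Set K := ⋂₀ {D : Set K | IsBallK D ∧ ofField '' D ∈ S.1}

/-- Rational points: the non-convergent filters whose balls of `K` intersect in a closed ball. -/
def IsRational (S : Ber K) : Prop := ¬ S.IsClassical ∧ IsClosedBallK S.core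

/-- Irrational points: the non-convergent filters whose balls of `K` intersect in an irrational
ball. -/
def IsIrrational (S : Ber K) : Prop := ¬ S.IsClassical ∧ IsIrrationalBallK S.core

/-- Singular points: the non-convergent filters whose balls of `K` have empty intersection. -/
def IsSingular (S : Ber K) : Prop := ¬ S.IsClassical ∧ S.core = ∅

/-- `S` is the point determined by the ball `B` of the projective line: writing `D` for the one of
`B` and its complement that lies in `K`, the point `S` is the rational or irrational point given by
the closed or irrational ball of `K` that contains `D` and has the same diameter as `D`. -/
def IsDeterminedBy (S : Ber K) (B : Set (P1 K)) : Prop :=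
  ∃ D : Set K, (B = ofField '' D ∨ B = (ofField '' D)ᶜ) ∧
    (S.IsRational ∨ S.IsIrrational) ∧ D ⊆ S.core ∧ Metric.diam S.core = Metric.diam D

/-- `π(S)`: the open or irrational balls of the projective line that determine the point `S`. -/
def directions (S : Ber K) : Set (Set (P1 K)) :=
  {B | (IsOpenBall B ∨ IsIrrationalBall B) ∧ S.IsDeterminedBy B}

end Ber

end BerkovichLine

/-!
The coordinates `a ↦ |S - a|`, extended to the completion by continuity, embed the Berkovich line
into the space of ultrametric Katětov functions `K → [0, ∞]`. The infinite residue field provides,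
for every ball with radius in the value group and finitely many elements of `K`, a point of `K`
whose distances to these elements are those of a generic point of the ball. Hence every ball of
centre `x` and radius `t` gives a point of the line, with coordinates `a ↦ max(t, |x - a|)`; for
fixed `x` these points form an arc from `x` to `∞`, and together they are dense.

A half-space `{|T - a| < r}` or `{r < |T - a|}` is open, and its points given by balls are joined
inside it to a fixed one by such arcs, so it is connected. If `S` is given by the closed ball with
centre `a` and radius `r`, then the complement of `S` is the disjoint union of the half-spaces
`{r < |T - a|}` and `{|T - c| < r}` with `|c - a| ≤ r`, which are therefore its components. The
complement of a point of the projective line is a single half-space, and the complement of a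
singular point is a union of half-spaces `{r < |T - c|}`, all of which contain `∞`.
-/

namespace BerkovichLine

open Filter Topology ENNReal Set

section Topology

theorem setOfPred_connectedComponentIn_eq {X : Type*} [TopologicalSpace X] {F : Set X}
    {𝒜 : Set (Set X)} (hunion : ⋃₀ 𝒜 = F) (hopen : ∀ P ∈ 𝒜, IsOpen P)
    (hconn : ∀ P ∈ 𝒜, IsConnected P) (hdisj : 𝒜.PairwiseDisjoint id) :
    {A | ∃ x ∈ F, A = connectedComponentIn F x} = 𝒜 := by
  have component_eq : ∀ P ∈ 𝒜, ∀ x ∈ P, connectedComponentIn F x = P := by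
    intro P hP x hx
    have hPF : P ⊆ F := hunion ▸ subset_sUnion_of_mem hP
    refine Subset.antisymm ?_ ((hconn P hP).isPreconnected.subset_connectedComponentIn hx hPF)
    refine isPreconnected_connectedComponentIn.subset_left_of_subset_union (hopen P hP)
      (isOpen_sUnion fun Q (hQ : Q ∈ 𝒜 \ {P}) => hopen Q hQ.1) ?_ ?_
      ⟨x, mem_connectedComponentIn (hPF hx), hx⟩
    · exact disjoint_sUnion_right.2 fun Q hQ => hdisj hP hQ.1 (Ne.symm hQ.2)
    · rw [← sUnion_insert, insert_sdiff_singleton, insert_eq_of_mem hP, hunion]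
      exact connectedComponentIn_subset F x
  ext A
  constructor
  · rintro ⟨x, hx, rfl⟩
    obtain ⟨P, hP, hxP⟩ := hunion.symm ▸ hx
    rwa [component_eq P hP x hxP]
  · intro hA
    obtain ⟨x, hx⟩ := (hconn A hA).nonempty
    exact ⟨x, hunion ▸ mem_sUnion_of_mem hx hA, (component_eq A hA x hx).symm⟩

end Topology

section ValueGroup

variable {K : Type*} [NormedField K]

variable (K) in
/-- The value group written additively, as the group of the logarithms of its elements. -/
noncomputable def logValueGroup : AddSubgroup ℝ where
  carrier := Real.log '' valueGroup K
  zero_mem' := ⟨1, ⟨1, one_ne_zero, norm_one⟩, Real.log_one⟩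
  add_mem' := by
    rintro _ _ ⟨_, ⟨v, hv, rfl⟩, rfl⟩ ⟨_, ⟨w, hw, rfl⟩, rfl⟩
    exact ⟨_, ⟨v * w, mul_ne_zero hv hw, norm_mul v w⟩,
      Real.log_mul (norm_ne_zero_iff.2 hv) (norm_ne_zero_iff.2 hw)⟩
  neg_mem' := by
    rintro _ ⟨_, ⟨v, hv, rfl⟩, rfl⟩
    exact ⟨_, ⟨v⁻¹, inv_ne_zero hv, norm_inv v⟩, Real.log_inv ‖v‖⟩

theorem pos_of_mem_valueGroup {r : ℝ} (hr : r ∈ valueGroup K) : 0 < r := by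
  obtain ⟨z, hz, rfl⟩ := hr
  exact norm_pos_iff.2 hz

theorem dense_logValueGroup (h : ¬ DiscreteTopology (valueGroup K)) :
    Dense (logValueGroup K : Set ℝ) := by
  refine (logValueGroup K).dense_or_cyclic.resolve_right ?_
  rintro ⟨a, ha⟩
  rw [← AddSubgroup.zmultiples_eq_closure] at ha
  have : DiscreteTopology (logValueGroup K) := by
    rw [ha]
    infer_instance
  let log : valueGroup K → logValueGroup K := fun r => ⟨Real.log r, mem_image_of_mem _ r.2⟩
  have continuous_log : Continuous log :=
    (continuous_subtype_val.log fun r => (pos_of_mem_valueGroup r.2).ne').subtype_mk _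
  refine h (DiscreteTopology.of_continuous_injective continuous_log fun r s hrs => ?_)
  exact Subtype.ext (Real.log_injOn_pos (pos_of_mem_valueGroup r.2) (pos_of_mem_valueGroup s.2)
    (congrArg Subtype.val hrs))

/-- The densely normed field structure given by a value group that is not discrete. -/
abbrev denselyNormedFieldOfNotDiscrete (h : ¬ DiscreteTopology (valueGroup K)) :
    DenselyNormedField K where
  lt_norm_lt x y hx hxy := by
    obtain ⟨m, hxm, hmy⟩ := exists_between hxy
    have hm : 0 < m := hx.trans_lt hxm
    obtain ⟨_, ⟨_, ⟨w, hw, rfl⟩, rfl⟩, hmw, hwy⟩ :=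
      (dense_logValueGroup h).exists_between (Real.log_lt_log hm hmy)
    have hw : 0 < ‖w‖ := norm_pos_iff.2 hw
    exact ⟨w, hxm.trans ((Real.log_lt_log_iff hm hw).1 hmw),
      (Real.log_lt_log_iff hw (hm.trans hmy)).1 hwy⟩

end ValueGroup

section DenselyNormedField

variable {K : Type*} [DenselyNormedField K]

variable (K) in
theorem exists_enorm_between {p q : ℝ≥0∞} (h : p < q) : ∃ w : K, w ≠ 0 ∧ p < ‖w‖ₑ ∧ ‖w‖ₑ < q := by
  obtain ⟨r, hr, hpr, hrq⟩ := ENNReal.lt_iff_exists_real_btwn.1 h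
  obtain ⟨s, -, hrs, hsq⟩ := ENNReal.lt_iff_exists_real_btwn.1 hrq
  have hrs : r < s := (ENNReal.ofReal_lt_ofReal_iff_of_nonneg hr).1 hrs
  obtain ⟨w, hrw, hws⟩ := DenselyNormedField.lt_norm_lt (α := K) r s hr hrs
  have hrw' : ENNReal.ofReal r ≤ ‖w‖ₑ := ofReal_norm w ▸ ENNReal.ofReal_le_ofReal hrw.le
  have hws' : ‖w‖ₑ ≤ ENNReal.ofReal s := ofReal_norm w ▸ ENNReal.ofReal_le_ofReal hws.le
  exact ⟨w, norm_pos_iff.1 (hr.trans_lt hrw), hpr.trans_le hrw', hws'.trans_lt hsq⟩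

variable (K) in
theorem dense_setOfPred_enorm : Dense {t : ℝ≥0∞ | ∃ w : K, w ≠ 0 ∧ ‖w‖ₑ = t} :=
  dense_of_exists_between fun _ _ h =>
    let ⟨w, hw, h1, h2⟩ := exists_enorm_between K h
    ⟨_, ⟨w, hw, rfl⟩, h1, h2⟩

theorem le_of_forall_enorm_le {s t : ℝ≥0∞} (h : ∀ w : K, ‖w‖ₑ ≤ s → ‖w‖ₑ ≤ t) : s ≤ t := by
  by_contra! hlt
  obtain ⟨w, -, htw, hws⟩ := exists_enorm_between K hlt
  exact htw.not_ge (h w hws.le)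

end DenselyNormedField

section Ultrametric

variable {X : Type*} [PseudoMetricSpace X] [IsUltrametricDist X]

theorem edist_triangle_max (a b c : X) : edist a c ≤ max (edist a b) (edist b c) := by
  simp only [edist_dist, ← ENNReal.ofReal_max]
  exact ENNReal.ofReal_le_ofReal (dist_triangle_max a b c)

theorem diam_closedBall_le (a : X) {r : ℝ} (hr : 0 ≤ r) : Metric.diam (Metric.closedBall a r) ≤ r :=
  Metric.diam_le_of_forall_dist_le hr fun x hx y hy =>
    (dist_triangle_max x a y).trans (max_le hx (dist_comm a y ▸ hy))

end Ultrametric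

section UltrametricField

variable {K : Type*} [DenselyNormedField K] [IsUltrametricDist K]

theorem diam_ball (a : K) {r : ℝ} (hr : 0 ≤ r) : Metric.diam (Metric.ball a r) = r := by
  refine le_antisymm ((Metric.diam_mono Metric.ball_subset_closedBall
    Metric.isBounded_closedBall).trans (diam_closedBall_le a hr)) (le_of_forall_lt fun s hs => ?_)
  rcases lt_or_ge s 0 with hs0 | hs0
  · exact hs0.trans_le Metric.diam_nonneg
  obtain ⟨w, hsw, hwr⟩ := DenselyNormedField.lt_norm_lt (α := K) s r hs0 hs
  have hwa : w + a ∈ Metric.ball a r := by simpa [mem_ball_iff_norm] using hwr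
  calc s < dist (w + a) a := by simpa [dist_eq_norm] using hsw
    _ ≤ Metric.diam (Metric.ball a r) :=
      Metric.dist_le_diam_of_mem Metric.isBounded_ball hwa
        (Metric.mem_ball_self ((norm_nonneg w).trans_lt hwr))

theorem diam_closedBall (a : K) {r : ℝ} (hr : 0 ≤ r) : Metric.diam (Metric.closedBall a r) = r :=
  le_antisymm (diam_closedBall_le a hr) ((diam_ball a hr).ge.trans
    (Metric.diam_mono Metric.ball_subset_closedBall Metric.isBounded_closedBall))

end UltrametricField

section Katetov

variable {X : Type*} [PseudoEMetricSpace X]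

/-- Ultrametric Katětov functions: the distance functions `a ↦ d(x, a)` of the points `x` at finite
or infinite distance in ultrametric extensions of `X`. The coordinates of the points of the
Berkovich line are functions of this kind on `K`. -/
structure IsKatetov (f : X → ℝ≥0∞) : Prop where
  le_max : ∀ a b, f a ≤ max (f b) (edist b a)
  edist_le_max : ∀ a b, edist a b ≤ max (f a) (f b)

theorem isClosed_setOfPred_isKatetov : IsClosed {f : X → ℝ≥0∞ | IsKatetov f} := by
  have isKatetov_iff : ∀ f : X → ℝ≥0∞, IsKatetov f ↔
      (∀ a b, f a ≤ max (f b) (edist b a)) ∧ ∀ a b, edist a b ≤ max (f a) (f b) :=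
    fun f => ⟨fun h => ⟨h.1, h.2⟩, fun h => ⟨h.1, h.2⟩⟩
  simp only [isKatetov_iff, ofPred_and, ofPred_forall]
  exact .inter
    (isClosed_iInter fun a => isClosed_iInter fun b =>
      isClosed_le (continuous_apply a) ((continuous_apply b).max continuous_const))
    (isClosed_iInter fun a => isClosed_iInter fun b =>
      isClosed_le continuous_const ((continuous_apply a).max (continuous_apply b)))

theorem IsKatetov.eq_edist_of_lt {f : X → ℝ≥0∞} (hf : IsKatetov f) {a c : X}
    (h : f c < edist c a) : f a = edist c a :=
  le_antisymm ((hf.le_max a c).trans (max_le h.le le_rfl))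
    ((le_max_iff.1 (hf.edist_le_max c a)).resolve_left h.not_ge)

theorem IsKatetov.edist_eq_of_lt {f : X → ℝ≥0∞} (hf : IsKatetov f) {a c : X}
    (h : f c < f a) : edist c a = f a :=
  le_antisymm ((hf.edist_le_max c a).trans (max_le h.le le_rfl))
    ((le_max_iff.1 (hf.le_max a c)).resolve_left h.not_ge)

theorem IsKatetov.eq_of_le {f g : X → ℝ≥0∞} (hf : IsKatetov f) (hg : IsKatetov g) (hgf : g ≤ f)
    (h : ∀ a, ∃ c, f c < f a) : g = f := by
  ext a
  obtain ⟨c, hc⟩ := h a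
  have hca := hf.edist_eq_of_lt hc
  rw [hg.eq_edist_of_lt ((hgf c).trans_lt (hca ▸ hc)), hca]

/-- The function `a ↦ max(t, |x - a|)`: the coordinates of the point given by the ball of centre `x`
and radius `t`. -/
noncomputable def cone (x : X) (t : ℝ≥0∞) : X → ℝ≥0∞ := fun a => max t (edist x a)

theorem continuous_cone (x : X) : Continuous (cone x) :=
  continuous_pi fun _ => continuous_id.max continuous_const

@[simp]
theorem cone_self (x : X) (t : ℝ≥0∞) : cone x t x = t := by simp [cone]

theorem cone_top (x : X) : cone x ⊤ = ⊤ := by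
  ext a
  simp [cone]

theorem IsKatetov.le_cone {f : X → ℝ≥0∞} (hf : IsKatetov f) {a : X} {r : ℝ≥0∞} (h : f a ≤ r) :
    f ≤ cone a r := fun c => (hf.le_max c a).trans (max_le_max h le_rfl)

theorem IsKatetov.eq_cone_of_forall_le {f : X → ℝ≥0∞} (hf : IsKatetov f) {a : X}
    (h : ∀ c, f a ≤ f c) : f = cone a (f a) :=
  le_antisymm (hf.le_cone le_rfl) fun c =>
    max_le (h c) ((hf.edist_le_max a c).trans (max_le (h c) le_rfl))

theorem IsKatetov.ne_cone_iff {f : X → ℝ≥0∞} (hf : IsKatetov f) {a : X} {r : ℝ≥0∞} :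
    f ≠ cone a r ↔ r < f a ∨ ∃ c, edist c a ≤ r ∧ f c < r := by
  constructor
  · intro hne
    by_contra! h
    obtain ⟨ha, hc⟩ := h
    have har : f a = r := le_antisymm ha (hc a (by simp))
    refine hne (har ▸ hf.eq_cone_of_forall_le fun c => ?_)
    rcases le_or_gt (edist c a) r with hca | hca
    · exact har ▸ hc c hca
    · rw [har, hf.eq_edist_of_lt (a := c) (c := a) (by rwa [har, edist_comm]), edist_comm]
      exact hca.le
  · rintro (h | ⟨c, -, hc⟩) rfl
    · exact h.ne' (cone_self a r)
    · exact hc.not_ge (le_max_left _ _)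

end Katetov

section UltrametricCones

variable {X : Type*} [PseudoMetricSpace X] [IsUltrametricDist X]

theorem isKatetov_cone (x : X) (t : ℝ≥0∞) : IsKatetov (cone x t) where
  le_max a b := by
    rw [cone, cone, max_assoc]
    exact max_le_max le_rfl (edist_triangle_max x b a)
  edist_le_max a b := (edist_triangle_max a x b).trans
    (max_le_max (edist_comm a x ▸ le_max_right _ _) (le_max_right _ _))

theorem cone_le_cone {x y : X} {t : ℝ≥0∞} (h : edist x y ≤ t) : cone x t ≤ cone y t := fun a =>
  max_le (le_max_left _ _) ((edist_triangle_max x y a).trans (max_le_max h le_rfl))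

theorem cone_eq_cone {x y : X} {t : ℝ≥0∞} (h : edist x y ≤ t) : cone x t = cone y t :=
  le_antisymm (cone_le_cone h) (cone_le_cone (edist_comm x y ▸ h))

end UltrametricCones

theorem closedBall_eq_setOfPred {E : Type*} [SeminormedAddCommGroup E] (a : E) (r : ℝ) :
    Metric.closedBall a r = {z | ‖z - a‖ ≤ r} := by
  ext z
  exact mem_closedBall_iff_norm

section ProjectiveLine

variable {K : Type*} [NormedField K]

theorem ofField_injective : Function.Injective (ofField : K → P1 K) := by
  intro x y h
  obtain ⟨c, hc⟩ := (Projectivization.mk_eq_mk_iff' K _ _ _ _).1 h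
  have hc1 : c = 1 := by simpa using congrArg Prod.snd hc
  simpa [hc1] using (congrArg Prod.fst hc).symm

theorem exists_notMem_range_ofField : ∃ p : P1 K, p ∉ range (ofField : K → P1 K) := by
  refine ⟨Projectivization.mk K ((1, 0) : K × K) fun h => one_ne_zero (congrArg Prod.fst h), ?_⟩
  rintro ⟨x, h⟩
  obtain ⟨c, hc⟩ := (Projectivization.mk_eq_mk_iff' K _ _ _ _).1 h
  exact zero_ne_one (α := K) (by simpa using congrArg Prod.snd hc)

/-- The distance `|p - a|` of a point of the projective line to `a : K`, infinite for `p = ∞`. -/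
noncomputable def edistTo (p : P1 K) (a : K) : ℝ≥0∞ := ⨅ (z : K) (_ : ofField z = p), edist z a

theorem edistTo_ofField (z : K) : edistTo (ofField z) = edist z := by
  ext a
  refine le_antisymm (iInf₂_le (f := fun y (_ : ofField y = ofField z) => edist y a) z rfl)
    (le_iInf₂ fun y hy => ?_)
  rw [ofField_injective hy]

theorem edistTo_eq_top {p : P1 K} (hp : p ∉ range (ofField : K → P1 K)) : edistTo p = ⊤ :=
  funext fun _ => top_le_iff.1 (le_iInf₂ fun y hy => (hp ⟨y, hy⟩).elim)

theorem exists_edistTo_eq_top : ∃ p : P1 K, edistTo p = ⊤ :=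
  let ⟨p, hp⟩ := exists_notMem_range_ofField (K := K)
  ⟨p, edistTo_eq_top hp⟩

theorem exists_ofField_eq_of_edistTo_ne_top {p : P1 K} {a : K} (h : edistTo p a ≠ ⊤) :
    ∃ z, ofField z = p := by
  by_contra hp
  exact h (congrFun (edistTo_eq_top hp) a)

theorem exists_edistTo_eq_cone (p : P1 K) :
    ∃ x : K, edistTo p = cone x 0 ∨ edistTo p = cone x ⊤ := by
  by_cases hp : p ∈ range (ofField : K → P1 K)
  · obtain ⟨x, rfl⟩ := hp
    exact ⟨x, .inl (by ext a; simp [edistTo_ofField, cone])⟩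
  · exact ⟨0, .inr (by rw [edistTo_eq_top hp, cone_top])⟩

theorem isKatetov_edistTo [IsUltrametricDist K] (p : P1 K) : IsKatetov (edistTo p) := by
  obtain ⟨x, h | h⟩ := exists_edistTo_eq_cone p <;>
  · rw [h]
    exact isKatetov_cone x _

theorem isKatetov_of_tendsto [IsUltrametricDist K] {F : Filter (P1 K)} [F.NeBot] {f : K → ℝ≥0∞}
    (h : Tendsto edistTo F (𝓝 f)) : IsKatetov f :=
  isClosed_setOfPred_isKatetov.mem_of_tendsto h (.of_forall isKatetov_edistTo)

theorem image_ball (a : K) (r : ℝ) :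
    ofField '' Metric.ball a r = {p | edistTo p a < ENNReal.ofReal r} := by
  ext p
  constructor
  · rintro ⟨z, hz, rfl⟩
    simpa [edistTo_ofField, edist_lt_ofReal] using hz
  · intro h
    obtain ⟨z, rfl⟩ := exists_ofField_eq_of_edistTo_ne_top (ne_top_of_lt h)
    exact ⟨z, by simpa [edistTo_ofField, edist_lt_ofReal] using h, rfl⟩

theorem image_closedBall (a : K) {r : ℝ} (hr : 0 ≤ r) :
    ofField '' Metric.closedBall a r = {p | edistTo p a ≤ ENNReal.ofReal r} := by
  ext p
  constructor
  · rintro ⟨z, hz, rfl⟩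
    simpa [edistTo_ofField, edist_le_ofReal hr] using hz
  · intro h
    obtain ⟨z, rfl⟩ := exists_ofField_eq_of_edistTo_ne_top (ne_top_of_le_ne_top ofReal_ne_top h)
    exact ⟨z, by simpa [edistTo_ofField, edist_le_ofReal hr] using h, rfl⟩

theorem compl_image_closedBall (a : K) {r : ℝ} (hr : 0 ≤ r) :
    (ofField '' Metric.closedBall a r)ᶜ = {p | ENNReal.ofReal r < edistTo p a} := by
  rw [image_closedBall a hr]
  ext p
  simp

theorem isOpenBall_iff {B : Set (P1 K)} : IsOpenBall B ↔ ∃ a w : K, w ≠ 0 ∧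
    (B = {p | edistTo p a < ‖w‖ₑ} ∨ B = {p | ‖w‖ₑ < edistTo p a}) := by
  have image_ball_norm (a w : K) :
      ofField '' {z : K | ‖z - a‖ < ‖w‖} = {p | edistTo p a < ‖w‖ₑ} := by
    rw [← ball_eq, image_ball, ofReal_norm]
  have compl_image_closedBall_norm (a w : K) :
      (ofField '' {z : K | ‖z - a‖ ≤ ‖w‖})ᶜ = {p | ‖w‖ₑ < edistTo p a} := by
    rw [← closedBall_eq_setOfPred, compl_image_closedBall a (norm_nonneg w), ofReal_norm]
  constructor
  · rintro (⟨_, ⟨a, _, ⟨w, hw, rfl⟩, rfl⟩, rfl⟩ | ⟨_, ⟨a, _, ⟨w, hw, rfl⟩, rfl⟩, rfl⟩)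
    · exact ⟨a, w, hw, .inl (image_ball_norm a w)⟩
    · exact ⟨a, w, hw, .inr (compl_image_closedBall_norm a w)⟩
  · rintro ⟨a, w, hw, rfl | rfl⟩
    · exact .inl ⟨_, ⟨a, _, ⟨w, hw, rfl⟩, rfl⟩, (image_ball_norm a w).symm⟩
    · exact .inr ⟨_, ⟨a, _, ⟨w, hw, rfl⟩, rfl⟩, (compl_image_closedBall_norm a w).symm⟩

theorem IsOpenBall.isOpenAffinoid {B : Set (P1 K)} (hB : IsOpenBall B) : IsOpenAffinoid B :=
  ⟨{B}, finite_singleton B, by rintro _ rfl; exact hB, (sInter_singleton B).symm⟩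

theorem prod_subset_coverEntourage {C : Set (Set (P1 K))} {Y : Set (P1 K)} (hY : Y ∈ C) :
    Y ×ˢ Y ⊆ coverEntourage C := fun _ hp => mem_biUnion hY hp

end ProjectiveLine

section Entourages

variable {K : Type*} [DenselyNormedField K]

theorem setOfPred_lt_or_lt_mem_entourages (a : K) {r s : ℝ≥0∞} (hrs : r < s) :
    {q : P1 K × P1 K | (edistTo q.1 a < s ∧ edistTo q.2 a < s) ∨
      (r < edistTo q.1 a ∧ r < edistTo q.2 a)} ∈ entourages K := by
  obtain ⟨w, hw, hrw, hws⟩ := exists_enorm_between K hrs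
  obtain ⟨v, hv, hrv, hvw⟩ := exists_enorm_between K hrw
  refine ⟨{{p | edistTo p a < ‖w‖ₑ}, {p | ‖v‖ₑ < edistTo p a}}, ⟨by simp, ?_, ?_⟩, ?_⟩
  · rintro Y (rfl | rfl)
    · exact (isOpenBall_iff.2 ⟨a, w, hw, .inl rfl⟩).isOpenAffinoid
    · exact (isOpenBall_iff.2 ⟨a, v, hv, .inr rfl⟩).isOpenAffinoid
  · refine eq_univ_of_forall fun p => ?_
    rw [sUnion_pair]
    exact (lt_or_ge (edistTo p a) ‖w‖ₑ).imp id hvw.trans_le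
  · refine iUnion₂_subset ?_
    rintro Y (rfl | rfl) ⟨p, q⟩ ⟨hp, hq⟩
    · exact .inl ⟨lt_trans hp hws, lt_trans hq hws⟩
    · exact .inr ⟨lt_trans hrv hp, lt_trans hrv hq⟩

theorem forall_lt_or_forall_lt_of_prod_subset {a : K} {r s : ℝ≥0∞} {Y : Set (P1 K)}
    (h : Y ×ˢ Y ⊆ {q : P1 K × P1 K | (edistTo q.1 a < s ∧ edistTo q.2 a < s) ∨
      (r < edistTo q.1 a ∧ r < edistTo q.2 a)}) :
    (∀ p ∈ Y, edistTo p a < s) ∨ ∀ p ∈ Y, r < edistTo p a := by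
  by_contra! hY
  obtain ⟨⟨p, hp, hps⟩, q, hq, hqr⟩ := hY
  rcases h (mk_mem_prod hp hq) with h | h
  exacts [hps.not_gt h.1, hqr.not_gt h.2]

theorem IsCauchy.eventually_lt_or_eventually_lt {F : Filter (P1 K)} (hF : IsCauchy F) (a : K)
    {r s : ℝ≥0∞} (hrs : r < s) : (∀ᶠ p in F, edistTo p a < s) ∨ ∀ᶠ p in F, r < edistTo p a := by
  obtain ⟨Y, hYF, hY⟩ := hF.2 _ (setOfPred_lt_or_lt_mem_entourages a hrs)
  exact (forall_lt_or_forall_lt_of_prod_subset hY).imp (mem_of_superset hYF) (mem_of_superset hYF)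

theorem IsCauchy.exists_tendsto {F : Filter (P1 K)} (hF : IsCauchy F) :
    ∃ f, Tendsto edistTo F (𝓝 f) := by
  have exists_tendsto_apply (a : K) : ∃ t, Tendsto (fun p => edistTo p a) F (𝓝 t) := by
    refine tendsto_of_no_upcrossings dense_univ fun r _ s _ hrs => ?_
    rintro ⟨hr, hs⟩
    obtain ⟨t, hrt, hts⟩ := exists_between hrs
    rcases hF.eventually_lt_or_eventually_lt a hts with h | h
    · exact hs (h.mono fun p => not_lt_of_gt)
    · exact hr (h.mono fun p hp => (hrt.trans hp).not_gt)
  choose f hf using exists_tendsto_apply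
  exact ⟨f, tendsto_pi_nhds.2 hf⟩

end Entourages

section ResidueField

variable {K : Type*} [NormedField K] [IsUltrametricDist K]
  [Infinite (IsLocalRing.ResidueField (NormedField.valuation (K := K)).valuationSubring)]

theorem exists_norm_le_one_forall_one_le_norm_sub {s : Set K} (hs : s.Finite) :
    ∃ u : K, ‖u‖ ≤ 1 ∧ ∀ c ∈ s, 1 ≤ ‖u - c‖ := by
  set O := (NormedField.valuation (K := K)).valuationSubring
  have mem_integers (x : K) : x ∈ O ↔ ‖x‖ ≤ 1 := Iff.rfl
  have finite_residues : (IsLocalRing.residue O '' (Subtype.val ⁻¹' s)).Finite :=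
    (hs.preimage Subtype.val_injective.injOn).image _
  obtain ⟨y, hy⟩ := finite_residues.infinite_compl.nonempty
  obtain ⟨u, rfl⟩ := IsLocalRing.residue_surjective y
  refine ⟨u, u.2, fun c hc => ?_⟩
  by_contra! huc
  have hcO : c ∈ O := by simpa using O.sub_mem u.2 ((mem_integers _).2 huc.le)
  refine hy ⟨⟨c, hcO⟩, hc, ?_⟩
  rw [eq_comm, ← sub_eq_zero, ← map_sub, IsLocalRing.residue_eq_zero_iff]
  exact (NormedField.valuation (K := K)).mem_maximalIdeal_iff.2 huc

theorem exists_eqOn_cone (x : K) {w : K} (hw : w ≠ 0) {s : Set K} (hs : s.Finite) :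
    ∃ z : K, EqOn (edist z) (cone x ‖w‖ₑ) s := by
  obtain ⟨u, hu, hus⟩ := exists_norm_le_one_forall_one_le_norm_sub
    (hs.image fun c => (c - x) / w)
  have hzx : edist (x + w * u) x ≤ ‖w‖ₑ := by
    rw [edist_eq_enorm_sub, enorm_le_iff_norm_le, add_sub_cancel_left, norm_mul]
    exact mul_le_of_le_one_right (norm_nonneg w) hu
  have hzc (c : K) (hc : c ∈ s) : ‖w‖ₑ ≤ edist (x + w * u) c := by
    have hscale : x + w * u - c = w * (u - (c - x) / w) := by
      field_simp
      ring
    rw [edist_eq_enorm_sub, enorm_le_iff_norm_le, hscale, norm_mul]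
    exact le_mul_of_one_le_right (norm_nonneg w) (hus _ (mem_image_of_mem _ hc))
  refine ⟨x + w * u, fun c hc => le_antisymm ?_ (max_le (hzc c hc) ?_)⟩
  · exact (edist_triangle_max _ x c).trans (max_le_max hzx le_rfl)
  · rw [edist_comm] at hzx
    exact (edist_triangle_max x _ c).trans (max_le (hzx.trans (hzc c hc)) le_rfl)

theorem IsKatetov.exists_le_edistTo {f : K → ℝ≥0∞} (hf : IsKatetov f) {s : Set K} (hs : s.Finite)
    {t : Set (K × K)} (ht : t.Finite) (hft : ∀ q ∈ t, q.2 ≠ 0 ∧ f q.1 ≤ ‖q.2‖ₑ) :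
    ∃ p : P1 K, (∀ c ∈ s, f c ≤ edistTo p c) ∧ ∀ q ∈ t, edistTo p q.1 ≤ ‖q.2‖ₑ := by
  rcases t.eq_empty_or_nonempty with rfl | ht'
  · obtain ⟨p, hp⟩ := exists_edistTo_eq_top (K := K)
    exact ⟨p, by simp [hp]⟩
  obtain ⟨⟨a, w⟩, haw, hmin⟩ := exists_min_image t (fun q => ‖q.2‖ₑ) ht ht'
  obtain ⟨hw, hfa⟩ := hft _ haw
  obtain ⟨z, hz⟩ := exists_eqOn_cone a hw (hs.union (ht.image Prod.fst))
  refine ⟨ofField z, fun c hc => ?_, fun q hq => ?_⟩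
  · rw [edistTo_ofField, hz (.inl hc)]
    exact hf.le_cone hfa c
  · rw [edistTo_ofField, hz (.inr (mem_image_of_mem _ hq))]
    have hwq : ‖w‖ₑ ≤ ‖q.2‖ₑ := hmin q hq
    exact max_le hwq ((hf.edist_le_max a q.1).trans (max_le (hfa.trans hwq) (hft q hq).2))

variable {F : Filter (P1 K)} [F.NeBot] {f : K → ℝ≥0∞}

theorem exists_forall_notMem_of_tendsto (h : Tendsto edistTo F (𝓝 f)) {𝓑 : Set (Set (P1 K))}
    (h𝓑 : 𝓑.Finite) (hball : ∀ B ∈ 𝓑, IsOpenBall B) (hF : ∀ B ∈ 𝓑, B ∉ F) :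
    ∃ p, ∀ B ∈ 𝓑, p ∉ B := by
  have lim (a : K) : Tendsto (fun p => edistTo p a) F (𝓝 (f a)) := tendsto_pi_nhds.1 h a
  have exists_center : ∀ B ∈ 𝓑, ∃ a w : K, w ≠ 0 ∧
      (B = {p | edistTo p a < ‖w‖ₑ} ∧ ‖w‖ₑ ≤ f a ∨ B = {p | ‖w‖ₑ < edistTo p a} ∧ f a ≤ ‖w‖ₑ) := by
    intro B hB
    obtain ⟨a, w, hw, rfl | rfl⟩ := isOpenBall_iff.1 (hball B hB)
    · exact ⟨a, w, hw, .inl ⟨rfl, not_lt.1 fun hlt => hF _ hB ((lim a).eventually_lt_const hlt)⟩⟩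
    · exact ⟨a, w, hw, .inr ⟨rfl, not_lt.1 fun hlt => hF _ hB ((lim a).eventually_const_lt hlt)⟩⟩
  choose! a w hw hBaw using exists_center
  obtain ⟨p, hpa, hpw⟩ := (isKatetov_of_tendsto h).exists_le_edistTo (h𝓑.image a)
    (t := (fun B => (a B, w B)) '' {B ∈ 𝓑 | f (a B) ≤ ‖w B‖ₑ})
    ((h𝓑.subset (sep_subset _ _)).image _)
    (by rintro _ ⟨B, ⟨hB, hfB⟩, rfl⟩; exact ⟨hw B hB, hfB⟩)
  refine ⟨p, fun B hB hpB => ?_⟩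
  rcases hBaw B hB with ⟨hBeq, hle⟩ | ⟨hBeq, hle⟩ <;> rw [hBeq] at hpB
  · exact (hle.trans (hpa _ (mem_image_of_mem a hB))).not_gt hpB
  · exact (hpw _ ⟨B, ⟨hB, hle⟩, rfl⟩).not_gt hpB

theorem exists_mem_cover_of_tendsto (h : Tendsto edistTo F (𝓝 f)) {C : Set (Set (P1 K))}
    (hC : IsFiniteAffinoidCover C) : ∃ Y ∈ C, Y ∈ F := by
  by_contra! hCF
  have exists_ball : ∀ Y ∈ C, ∃ B, IsOpenBall B ∧ Y ⊆ B ∧ B ∉ F := by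
    intro Y hY
    obtain ⟨s, hs, hsball, rfl⟩ := hC.2.1 Y hY
    obtain ⟨B, hB, hBF⟩ : ∃ B ∈ s, B ∉ F := by simpa [sInter_mem hs] using hCF _ hY
    exact ⟨B, hsball B hB, sInter_subset_of_mem hB, hBF⟩
  choose! B hball hYB hBF using exists_ball
  obtain ⟨p, hp⟩ := exists_forall_notMem_of_tendsto h (hC.1.image B) (forall_mem_image.2 hball)
    (forall_mem_image.2 hBF)
  obtain ⟨Y, hY, hpY⟩ : p ∈ ⋃₀ C := hC.2.2 ▸ mem_univ p
  exact hp _ (mem_image_of_mem B hY) (hYB Y hY hpY)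

theorem isCauchy_of_tendsto (h : Tendsto edistTo F (𝓝 f)) : IsCauchy F := by
  refine ⟨‹F.NeBot›, ?_⟩
  rintro V ⟨C, hC, hCV⟩
  obtain ⟨Y, hY, hYF⟩ := exists_mem_cover_of_tendsto h hC
  exact ⟨Y, hYF, (prod_subset_coverEntourage hY).trans hCV⟩

end ResidueField

section Completion

variable {K : Type*} [DenselyNormedField K] [IsUltrametricDist K]
  [Infinite (IsLocalRing.ResidueField (NormedField.valuation (K := K)).valuationSubring)]

theorem cone_mem_closure_range_edistTo (x : K) (t : ℝ≥0∞) :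
    cone x t ∈ closure (range (edistTo : P1 K → K → ℝ≥0∞)) := by
  refine closure_minimal ?_ (isClosed_closure.preimage (continuous_cone x))
    (dense_setOfPred_enorm K t)
  rintro _ ⟨w, hw, rfl⟩
  refine mem_closure_iff_nhds.2 fun W hW => ?_
  rw [nhds_pi, Filter.mem_pi] at hW
  obtain ⟨I, hI, u, hu, hIu⟩ := hW
  obtain ⟨z, hz⟩ := exists_eqOn_cone x hw hI
  refine ⟨edistTo (ofField z), hIu fun c hc => ?_, mem_range_self _⟩
  rw [edistTo_ofField, hz hc]
  exact mem_of_mem_nhds (hu c)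

theorem maximal_isCauchy_comap {f : K → ℝ≥0∞}
    (hf : f ∈ closure (range (edistTo : P1 K → K → ℝ≥0∞))) :
    Maximal IsCauchy (comap (edistTo : P1 K → K → ℝ≥0∞) (𝓝 f)) := by
  have := comap_neBot_iff_frequently.2 (mem_closure_iff_frequently.1 hf)
  refine ⟨isCauchy_of_tendsto tendsto_comap, fun G hG hle => ?_⟩
  obtain ⟨g, hg⟩ := hG.exists_tendsto
  obtain rfl : f = g := tendsto_nhds_unique tendsto_comap (hg.mono_left hle)
  exact tendsto_iff_comap.1 hg

end Completion

namespace Ber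

section Coordinates

variable {K : Type*} [DenselyNormedField K]

instance neBot (S : Ber K) : S.1.NeBot := S.2.prop.1

/-- The coordinates of a point: the limits `a ↦ |S - a|` of the distances along the filter. -/
noncomputable def coord (S : Ber K) : K → ℝ≥0∞ := limUnder S.1 edistTo

theorem tendsto_coord (S : Ber K) : Tendsto edistTo S.1 (𝓝 S.coord) :=
  tendsto_nhds_limUnder S.2.prop.exists_tendsto

theorem coord_eq_of_tendsto {S : Ber K} {f : K → ℝ≥0∞} (h : Tendsto edistTo S.1 (𝓝 f)) :
    S.coord = f :=
  tendsto_nhds_unique S.tendsto_coord h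

theorem tendsto_coord_apply (S : Ber K) (a : K) :
    Tendsto (fun p => edistTo p a) S.1 (𝓝 (S.coord a)) :=
  tendsto_pi_nhds.1 S.tendsto_coord a

theorem coord_le_or_le_coord {S T : Ber K} {a : K} {r s : ℝ≥0∞} {Y : Set (P1 K)}
    (hS : Y ∈ S.1) (hT : Y ∈ T.1)
    (h : Y ×ˢ Y ⊆ {q : P1 K × P1 K | (edistTo q.1 a < s ∧ edistTo q.2 a < s) ∨
      (r < edistTo q.1 a ∧ r < edistTo q.2 a)}) :
    (S.coord a ≤ s ∧ T.coord a ≤ s) ∨ (r ≤ S.coord a ∧ r ≤ T.coord a) := by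
  refine (forall_lt_or_forall_lt_of_prod_subset h).imp (fun h => ⟨?_, ?_⟩) fun h => ⟨?_, ?_⟩
  · exact le_of_tendsto (S.tendsto_coord_apply a) (mem_of_superset hS fun p hp => (h p hp).le)
  · exact le_of_tendsto (T.tendsto_coord_apply a) (mem_of_superset hT fun p hp => (h p hp).le)
  · exact ge_of_tendsto (S.tendsto_coord_apply a) (mem_of_superset hS fun p hp => (h p hp).le)
  · exact ge_of_tendsto (T.tendsto_coord_apply a) (mem_of_superset hT fun p hp => (h p hp).le)

theorem continuous_coord : Continuous (coord : Ber K → K → ℝ≥0∞) := by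
  refine continuous_pi fun a => OrderTopology.continuous_iff.2 fun t =>
    ⟨fun S (hS : t < S.coord a) => ?_, fun S (hS : S.coord a < t) => ?_⟩
  · obtain ⟨r, htr, hr⟩ := exists_between hS
    obtain ⟨s, hrs, hs⟩ := exists_between hr
    refine ⟨_, setOfPred_lt_or_lt_mem_entourages a hrs, fun T ⟨Y, hYS, hYT, hY⟩ => ?_⟩
    rcases coord_le_or_le_coord hYS hYT hY with h | h
    exacts [(hs.not_ge h.1).elim, htr.trans_le h.2]
  · obtain ⟨s, hs, hst⟩ := exists_between hS
    obtain ⟨r, hr, hrs⟩ := exists_between hs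
    refine ⟨_, setOfPred_lt_or_lt_mem_entourages a hrs, fun T ⟨Y, hYS, hYT, hY⟩ => ?_⟩
    rcases coord_le_or_le_coord hYS hYT hY with h | h
    exacts [h.2.trans_lt hst, (hr.not_ge h.1).elim]

theorem isOpen_coord_lt (a : K) (r : ℝ≥0∞) : IsOpen {T : Ber K | T.coord a < r} :=
  isOpen_lt ((continuous_apply a).comp continuous_coord) continuous_const

theorem isOpen_lt_coord (a : K) (r : ℝ≥0∞) : IsOpen {T : Ber K | r < T.coord a} :=
  isOpen_lt continuous_const ((continuous_apply a).comp continuous_coord)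

theorem IsClassical.exists_coord_eq_edistTo {S : Ber K} (hS : S.IsClassical) :
    ∃ p, S.coord = edistTo p := by
  obtain ⟨p, hp⟩ := hS
  refine ⟨p, coord_eq_of_tendsto (tendsto_pi_nhds.2 fun a => tendsto_order.2
    ⟨fun r hr => ?_, fun r hr => ?_⟩)⟩
  · filter_upwards [hp _ (setOfPred_lt_or_lt_mem_entourages a hr)] with q hq
    exact (hq.resolve_left fun h => h.1.false).2
  · filter_upwards [hp _ (setOfPred_lt_or_lt_mem_entourages a hr)] with q hq
    exact (hq.resolve_right fun h => h.1.false).2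

theorem isKatetov_coord [IsUltrametricDist K] (S : Ber K) : IsKatetov S.coord :=
  isKatetov_of_tendsto S.tendsto_coord

end Coordinates

section Inducing

variable {K : Type*} [DenselyNormedField K] [IsUltrametricDist K]
  [Infinite (IsLocalRing.ResidueField (NormedField.valuation (K := K)).valuationSubring)]

theorem filter_eq_comap (S : Ber K) : S.1 = comap edistTo (𝓝 S.coord) := by
  have hle : S.1 ≤ comap edistTo (𝓝 S.coord) := tendsto_iff_comap.1 S.tendsto_coord
  have hcl : S.coord ∈ closure (range (edistTo : P1 K → K → ℝ≥0∞)) :=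
    mem_closure_of_tendsto S.tendsto_coord (.of_forall mem_range_self)
  exact le_antisymm hle (S.2.le_of_ge (maximal_isCauchy_comap hcl).prop hle)

theorem coord_injective : Function.Injective (coord : Ber K → K → ℝ≥0∞) := fun S T h =>
  Subtype.ext (by rw [S.filter_eq_comap, T.filter_eq_comap, h])

theorem hat_mem_comap_nhds {S : Ber K} {Y : Set (P1 K)} (hY : Y ∈ S.1) :
    hat Y ∈ comap coord (𝓝 S.coord) := by
  rw [filter_eq_comap] at hY
  obtain ⟨W, hW, hWY⟩ := hY
  refine ⟨{f | W ∈ 𝓝 f}, eventually_mem_nhds_iff.2 hW, fun T (hT : W ∈ 𝓝 T.coord) => ?_⟩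
  rw [hat, mem_ofPred_eq, filter_eq_comap]
  exact ⟨W, hT, hWY⟩

theorem isInducing_coord : IsInducing (coord : Ber K → K → ℝ≥0∞) := by
  refine ⟨le_antisymm continuous_coord.le_induced fun O hO => ?_⟩
  refine (@isOpen_iff_mem_nhds _ (.induced coord inferInstance) _).2 fun S hS => ?_
  obtain ⟨V, ⟨C, hC, hCV⟩, hVO⟩ := hO S hS
  obtain ⟨Y, hY, hYS⟩ := exists_mem_cover_of_tendsto S.tendsto_coord hC
  rw [nhds_induced]
  exact mem_of_superset (hat_mem_comap_nhds hYS) fun T hYT =>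
    hVO ⟨Y, hYS, hYT, (prod_subset_coverEntourage hY).trans hCV⟩

theorem isOpen_hat (Y : Set (P1 K)) : IsOpen (hat Y) := by
  refine isOpen_iff_mem_nhds.2 fun S hS => ?_
  rw [isInducing_coord.nhds_eq_comap]
  exact hat_mem_comap_nhds hS

/-- The point given by the ball of centre `x` and radius `t`, a classical point for `t = 0` and
`t = ∞`. -/
noncomputable def ofBall (x : K) (t : ℝ≥0∞) : Ber K :=
  ⟨comap edistTo (𝓝 (cone x t)), maximal_isCauchy_comap (cone_mem_closure_range_edistTo x t)⟩

theorem coord_ofBall (x : K) (t : ℝ≥0∞) : (ofBall x t).coord = cone x t :=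
  coord_eq_of_tendsto tendsto_comap

theorem continuous_ofBall (x : K) : Continuous (ofBall x) := by
  refine isInducing_coord.continuous_iff.2 ?_
  simpa only [Function.comp_def, coord_ofBall] using continuous_cone x

theorem ofBall_eq_ofBall {x y : K} {t : ℝ≥0∞} (h : edist x y ≤ t) : ofBall x t = ofBall y t :=
  coord_injective (by rw [coord_ofBall, coord_ofBall, cone_eq_cone h])

theorem dense_setOfPred_ofBall : Dense {T : Ber K | ∃ x t, ofBall x t = T} := by
  refine isInducing_coord.dense_iff.2 fun S =>
    mem_closure_of_tendsto S.tendsto_coord (.of_forall fun p => ?_)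
  obtain ⟨x, hp | hp⟩ := exists_edistTo_eq_cone p
  · exact ⟨_, ⟨x, 0, rfl⟩, by rw [coord_ofBall, hp]⟩
  · exact ⟨_, ⟨x, ⊤, rfl⟩, by rw [coord_ofBall, hp]⟩

end Inducing

section Membership

variable {K : Type*} [DenselyNormedField K] [IsUltrametricDist K]

theorem eventually_edistTo_eq_coord {S : Ber K} {a c : K} (h : S.coord c < S.coord a) :
    ∀ᶠ p in S.1, edistTo p a = S.coord a := by
  have hca := S.isKatetov_coord.edist_eq_of_lt h
  filter_upwards [(S.tendsto_coord_apply c).eventually_lt_const h] with p hp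
  rw [← hca] at hp ⊢
  exact (isKatetov_edistTo p).eq_edist_of_lt hp

variable [Infinite (IsLocalRing.ResidueField (NormedField.valuation (K := K)).valuationSubring)]

theorem eq_ofBall_of_forall_coord_le {S : Ber K} {a : K} (h : ∀ c, S.coord a ≤ S.coord c) :
    S = ofBall a (S.coord a) :=
  coord_injective ((S.isKatetov_coord.eq_cone_of_forall_le h).trans (coord_ofBall a _).symm)

theorem preimage_edistTo_mem_iff {S : Ber K} {a : K} {U : Set ℝ≥0∞}
    (hU : interior (closure U) = U) : (edistTo · a) ⁻¹' U ∈ S.1 ↔ S.coord a ∈ U := by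
  refine ⟨fun h => ?_, fun h => S.tendsto_coord_apply a ((hU ▸ isOpen_interior).mem_nhds h)⟩
  by_cases hc : ∃ c, S.coord c < S.coord a
  · obtain ⟨c, hc⟩ := hc
    obtain ⟨p, hp, hpU⟩ := ((eventually_edistTo_eq_coord hc).and h).exists
    exact hp ▸ hpU
  · push Not at hc
    have hsub : ofBall a ⁻¹' hat ((edistTo · a) ⁻¹' U) ⊆ closure U := fun t ht => by
      simpa only [coord_ofBall, cone_self] using
        mem_closure_of_tendsto ((ofBall a t).tendsto_coord_apply a) ht
    have hmem : S.coord a ∈ ofBall a ⁻¹' hat ((edistTo · a) ⁻¹' U) := by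
      rwa [mem_preimage, ← eq_ofBall_of_forall_coord_le hc]
    exact hU ▸ interior_maximal hsub ((isOpen_hat _).preimage (continuous_ofBall a)) hmem

theorem hat_image_ball (c : K) {r : ℝ} (hr : 0 < r) :
    hat (ofField '' Metric.ball c r) = {T | T.coord c < ENNReal.ofReal r} := by
  have hU : interior (closure (Iio (ENNReal.ofReal r))) = Iio (ENNReal.ofReal r) := by
    rw [closure_Iio' ⟨0, ofReal_pos.2 hr⟩, interior_Iic' ⟨⊤, ofReal_lt_top⟩]
  rw [image_ball]
  exact ext fun _ => preimage_edistTo_mem_iff hU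

theorem hat_compl_image_closedBall (c : K) {r : ℝ} (hr : 0 < r) :
    hat (ofField '' Metric.closedBall c r)ᶜ = {T | ENNReal.ofReal r < T.coord c} := by
  have hU : interior (closure (Ioi (ENNReal.ofReal r))) = Ioi (ENNReal.ofReal r) := by
    rw [closure_Ioi' ⟨⊤, ofReal_lt_top⟩, interior_Ici' ⟨0, ofReal_pos.2 hr⟩]
  rw [compl_image_closedBall c hr.le]
  exact ext fun _ => preimage_edistTo_mem_iff hU

end Membership

section HalfSpaces

variable {K : Type*} [DenselyNormedField K] [IsUltrametricDist K]
  [Infinite (IsLocalRing.ResidueField (NormedField.valuation (K := K)).valuationSubring)]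

theorem isPreconnected_of_ofBall_mem_connectedComponentIn {E : Set (Ber K)} (hE : IsOpen E)
    {P : Ber K} (h : ∀ x t, ofBall x t ∈ E → ofBall x t ∈ connectedComponentIn E P) :
    IsPreconnected E := by
  refine isPreconnected_connectedComponentIn.subset_closure (connectedComponentIn_subset E P)
    ((dense_setOfPred_ofBall.open_subset_closure_inter hE).trans (closure_mono ?_))
  rintro _ ⟨hT, x, t, rfl⟩
  exact h x t hT

theorem isConnected_lt_coord (a : K) {r : ℝ≥0∞} (hr : r < ⊤) :
    IsConnected {T : Ber K | r < T.coord a} := by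
  refine ⟨⟨ofBall a ⊤, by simpa [coord_ofBall] using hr⟩,
    isPreconnected_of_ofBall_mem_connectedComponentIn (P := ofBall a ⊤) (isOpen_lt_coord a r)
      fun x t hxt => ?_⟩
  have hI : OrdConnected {s : ℝ≥0∞ | r < max s (edist x a)} :=
    IsUpperSet.ordConnected fun s t hst hs => hs.trans_le (max_le_max hst le_rfl)
  refine (hI.isPreconnected.image _ (continuous_ofBall x).continuousOn).subset_connectedComponentIn
    ⟨⊤, lt_max_of_lt_left hr, ofBall_eq_ofBall le_top⟩ ?_ ⟨t, ?_, rfl⟩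
  · rintro _ ⟨s, hs, rfl⟩
    rwa [mem_ofPred_eq, coord_ofBall]
  · rwa [mem_ofPred_eq, coord_ofBall] at hxt

theorem isConnected_coord_lt (a : K) {r : ℝ≥0∞} (hr : 0 < r) :
    IsConnected {T : Ber K | T.coord a < r} := by
  have hcomp : ∀ x s t, edist x a < r → s < r → t < r →
      ofBall x s ∈ connectedComponentIn {T | T.coord a < r} (ofBall x t) := by
    intro x s t hx hs ht
    refine (isPreconnected_Iio.image _
      (continuous_ofBall x).continuousOn).subset_connectedComponentIn
      (mem_image_of_mem _ ht) ?_ (mem_image_of_mem _ hs)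
    rintro _ ⟨s, hs, rfl⟩
    rw [mem_ofPred_eq, coord_ofBall]
    exact max_lt hs hx
  refine ⟨⟨ofBall a 0, by simpa [coord_ofBall] using hr⟩,
    isPreconnected_of_ofBall_mem_connectedComponentIn (P := ofBall a 0) (isOpen_coord_lt a r)
      fun x t hxt => ?_⟩
  rw [mem_ofPred_eq, coord_ofBall] at hxt
  obtain ⟨ht, hx⟩ : t < r ∧ edist x a < r := max_lt_iff.1 hxt
  have hmeet := hcomp a (edist x a) 0 (by simpa using hr) hx hr
  rw [← ofBall_eq_ofBall le_rfl] at hmeet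
  rw [connectedComponentIn_eq hmeet]
  exact hcomp x t _ hx ht hx

end HalfSpaces

end Ber

section Balls

variable {K : Type*} [NormedField K]

theorem ball_eq_closedBall_of_notMem_valueGroup {r : ℝ} (hr : 0 < r) (hr' : r ∉ valueGroup K)
    (a : K) : Metric.ball a r = Metric.closedBall a r := by
  refine Metric.ball_subset_closedBall.antisymm fun z hz =>
    Metric.mem_ball.2 (lt_of_le_of_ne hz fun h => ?_)
  rw [dist_eq_norm] at h
  exact hr' ⟨z - a, norm_pos_iff.1 (h ▸ hr), h⟩

theorem IsBallK.exists_eq {D : Set K} (hD : IsBallK D) :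
    ∃ c : K, ∃ s : ℝ, 0 < s ∧ (D = Metric.ball c s ∨ D = Metric.closedBall c s) := by
  simp only [ball_eq, closedBall_eq_setOfPred]
  rcases hD with ⟨c, s, hs, rfl⟩ | ⟨c, s, hs, rfl⟩ | ⟨c, s, hs, -, rfl⟩
  exacts [⟨c, s, pos_of_mem_valueGroup hs, .inl rfl⟩, ⟨c, s, pos_of_mem_valueGroup hs, .inr rfl⟩,
    ⟨c, s, hs, .inl rfl⟩]

theorem isOpenBall_or_isIrrationalBall_iff {B : Set (P1 K)} :
    IsOpenBall B ∨ IsIrrationalBall B ↔ ∃ c : K, ∃ s : ℝ, 0 < s ∧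
      (B = ofField '' Metric.ball c s ∨ B = (ofField '' Metric.closedBall c s)ᶜ) := by
  constructor
  · rintro ((⟨_, ⟨c, s, hs, rfl⟩, rfl⟩ | ⟨_, ⟨c, s, hs, rfl⟩, rfl⟩) |
      ⟨_, ⟨c, s, hs, hs', rfl⟩, rfl | rfl⟩)
    · exact ⟨c, s, pos_of_mem_valueGroup hs, .inl (by rw [ball_eq])⟩
    · exact ⟨c, s, pos_of_mem_valueGroup hs, .inr (by rw [closedBall_eq_setOfPred])⟩
    · exact ⟨c, s, hs, .inl (by rw [ball_eq])⟩
    · refine ⟨c, s, hs, .inr ?_⟩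
      rw [← ball_eq, ball_eq_closedBall_of_notMem_valueGroup hs hs']
  · rintro ⟨c, s, hs, rfl | rfl⟩ <;> by_cases hs' : s ∈ valueGroup K
    · exact .inl (.inl ⟨_, ⟨c, s, hs', ball_eq c s⟩, rfl⟩)
    · exact .inr ⟨_, ⟨c, s, hs, hs', ball_eq c s⟩, .inl rfl⟩
    · exact .inl (.inr ⟨_, ⟨c, s, hs', closedBall_eq_setOfPred c s⟩, rfl⟩)
    · rw [← ball_eq_closedBall_of_notMem_valueGroup hs hs']
      exact .inr ⟨_, ⟨c, s, hs, hs', ball_eq c s⟩, .inr rfl⟩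

theorem image_ofField_ne_compl_image_ofField (D E : Set K) : ofField '' D ≠ (ofField '' E)ᶜ := by
  obtain ⟨p, hp⟩ := exists_notMem_range_ofField (K := K)
  intro h
  have hpE : p ∈ (ofField '' E)ᶜ := fun hpE => hp (image_subset_range _ _ hpE)
  exact hp (image_subset_range _ _ (h ▸ hpE))

namespace Ber

theorem exists_core_eq_closedBall {S : Ber K} (hS : S.IsRational ∨ S.IsIrrational) :
    ∃ a : K, ∃ r : ℝ, 0 < r ∧ S.core = Metric.closedBall a r := by
  rcases hS with ⟨-, a, r, hr, h⟩ | ⟨-, a, r, hr, hr', h⟩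
  · exact ⟨a, r, pos_of_mem_valueGroup hr, by rw [h, closedBall_eq_setOfPred]⟩
  · exact ⟨a, r, hr, by rw [h, ← ball_eq, ball_eq_closedBall_of_notMem_valueGroup hr hr']⟩

theorem isDeterminedBy_image_iff {S : Ber K} {D : Set K} : S.IsDeterminedBy (ofField '' D) ↔
    (S.IsRational ∨ S.IsIrrational) ∧ D ⊆ S.core ∧ Metric.diam S.core = Metric.diam D := by
  refine ⟨fun ⟨E, hDE, h⟩ => ?_, fun h => ⟨D, .inl rfl, h⟩⟩
  obtain rfl : D = E := ofField_injective.image_injective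
    (hDE.resolve_right (image_ofField_ne_compl_image_ofField D E))
  exact h

theorem isDeterminedBy_compl_image_iff {S : Ber K} {D : Set K} :
    S.IsDeterminedBy (ofField '' D)ᶜ ↔
      (S.IsRational ∨ S.IsIrrational) ∧ D ⊆ S.core ∧ Metric.diam S.core = Metric.diam D := by
  refine ⟨fun ⟨E, hDE, h⟩ => ?_, fun h => ⟨D, .inr rfl, h⟩⟩
  obtain rfl : D = E := ofField_injective.image_injective
    (compl_injective (hDE.resolve_left (image_ofField_ne_compl_image_ofField E D).symm))
  exact h

end Ber

end Balls

namespace Ber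

section Directions

variable {K : Type*} [DenselyNormedField K] [IsUltrametricDist K]

theorem mem_directions_iff {S : Ber K} (hS : S.IsRational ∨ S.IsIrrational) {a : K} {r : ℝ}
    (hr : 0 < r) (h : S.core = Metric.closedBall a r) {B : Set (P1 K)} : B ∈ S.directions ↔
      (∃ c ∈ Metric.closedBall a r, B = ofField '' Metric.ball c r) ∨
        B = (ofField '' Metric.closedBall a r)ᶜ := by
  rw [directions, mem_ofPred_eq, isOpenBall_or_isIrrationalBall_iff]
  constructor
  · rintro ⟨⟨c, s, hs, rfl | rfl⟩, hB⟩
    · rw [isDeterminedBy_image_iff, h, diam_closedBall a hr.le, diam_ball c hs.le] at hB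
      obtain ⟨-, hsub, rfl⟩ := hB
      exact .inl ⟨c, hsub (Metric.mem_ball_self hr), rfl⟩
    · rw [isDeterminedBy_compl_image_iff, h, diam_closedBall a hr.le,
        diam_closedBall c hs.le] at hB
      obtain ⟨-, hsub, rfl⟩ := hB
      exact .inr (by
        rw [IsUltrametricDist.closedBall_eq_of_mem (hsub (Metric.mem_closedBall_self hr.le))])
  · rintro (⟨c, hc, rfl⟩ | rfl)
    · refine ⟨⟨c, r, hr, .inl rfl⟩, isDeterminedBy_image_iff.2 ⟨hS, ?_, ?_⟩⟩
      · rw [h, IsUltrametricDist.closedBall_eq_of_mem hc]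
        exact Metric.ball_subset_closedBall
      · rw [h, diam_closedBall a hr.le, diam_ball c hr.le]
    · exact ⟨⟨a, r, hr, .inr rfl⟩, isDeterminedBy_compl_image_iff.2 ⟨hS, h.ge, by rw [h]⟩⟩

end Directions

section Core

variable {K : Type*} [DenselyNormedField K] [IsUltrametricDist K]
  [Infinite (IsLocalRing.ResidueField (NormedField.valuation (K := K)).valuationSubring)]

theorem mem_core_iff {S : Ber K} {x : K} : x ∈ S.core ↔ ∀ c, S.coord x ≤ S.coord c := by
  constructor
  · intro hx c
    by_contra! hlt
    obtain ⟨w, hw, hcw, hwx⟩ := exists_enorm_between K hlt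
    rw [← ofReal_norm] at hcw
    have hball : S ∈ hat (ofField '' Metric.ball c ‖w‖) :=
      (hat_image_ball c (norm_pos_iff.2 hw)).symm ▸ hcw
    have hxc : x ∈ Metric.ball c ‖w‖ := hx _ ⟨.inl ⟨c, _, ⟨w, hw, rfl⟩, ball_eq c _⟩, hball⟩
    rw [← Metric.eball_ofReal, Metric.mem_eball, ofReal_norm, edist_comm,
      S.isKatetov_coord.edist_eq_of_lt hlt] at hxc
    exact hxc.not_gt hwx
  · rintro hx D ⟨hD, hDS⟩
    obtain ⟨c, s, hs, rfl | rfl⟩ := hD.exists_eq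
    · have hc : S.coord c < ENNReal.ofReal s := (hat_image_ball c hs).subset hDS
      rw [← Metric.eball_ofReal, Metric.mem_eball]
      exact (S.isKatetov_coord.edist_le_max x c).trans_lt (max_lt ((hx c).trans_lt hc) hc)
    · rw [image_closedBall c hs.le] at hDS
      have hc : S.coord c ≤ ENNReal.ofReal s := le_of_tendsto (S.tendsto_coord_apply c) hDS
      rw [← Metric.closedEBall_ofReal hs.le, Metric.mem_closedEBall]
      exact (S.isKatetov_coord.edist_le_max x c).trans (max_le ((hx c).trans hc) hc)

theorem eq_ofBall_of_core_eq {S : Ber K} {a : K} {r : ℝ} (hr : 0 ≤ r)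
    (h : S.core = Metric.closedBall a r) : S = ofBall a (ENNReal.ofReal r) := by
  have ha : ∀ c, S.coord a ≤ S.coord c := mem_core_iff.1 (h ▸ Metric.mem_closedBall_self hr)
  have hmem : ∀ x, edist x a ≤ S.coord a ↔ edist x a ≤ ENNReal.ofReal r := fun x => by
    rw [edist_le_ofReal hr, ← Metric.mem_closedBall, ← h, mem_core_iff]
    refine ⟨fun hx c => ?_, fun hx => ?_⟩
    · exact ((S.isKatetov_coord.le_max x a).trans
        (max_le le_rfl (edist_comm x a ▸ hx))).trans (ha c)
    · exact (S.isKatetov_coord.edist_le_max x a).trans (max_le (hx a) le_rfl)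
  have hw : ∀ w : K, ‖w‖ₑ ≤ S.coord a ↔ ‖w‖ₑ ≤ ENNReal.ofReal r := fun w => by
    simpa [edist_eq_enorm_sub] using hmem (w + a)
  rw [eq_ofBall_of_forall_coord_le ha, le_antisymm (le_of_forall_enorm_le fun w => (hw w).1)
    (le_of_forall_enorm_le fun w => (hw w).2)]

end Core

section Branches

variable {K : Type*} [DenselyNormedField K]

/-- The branches at the point `ofBall a r`: the half-space `{r < coord a}` towards infinity, and
the half-spaces `{coord c < r}` towards the points `c` of the closed ball. -/
def branches (a : K) (r : ℝ≥0∞) : Set (Set (Ber K)) :=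
  insert {T | r < T.coord a} {A | ∃ c, edist c a ≤ r ∧ A = {T | T.coord c < r}}

theorem isOpen_of_mem_branches {a : K} {r : ℝ≥0∞} {A : Set (Ber K)} (hA : A ∈ branches a r) :
    IsOpen A := by
  obtain rfl | ⟨c, -, rfl⟩ := hA
  exacts [isOpen_lt_coord a r, isOpen_coord_lt c r]

variable [IsUltrametricDist K]

theorem setOfPred_coord_lt_subset {c d : K} {r : ℝ≥0∞} (h : edist c d < r) :
    {T : Ber K | T.coord c < r} ⊆ {T | T.coord d < r} := fun T hT =>
  (T.isKatetov_coord.le_max d c).trans_lt (max_lt hT h)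

theorem pairwiseDisjoint_branches (a : K) (r : ℝ≥0∞) : (branches a r).PairwiseDisjoint id := by
  refine pairwiseDisjoint_insert.2 ⟨?_, ?_⟩
  · rintro _ ⟨c, -, rfl⟩ _ ⟨d, -, rfl⟩ hne
    refine disjoint_left.2 fun T hTc hTd => hne ?_
    have hcd : edist c d < r := (T.isKatetov_coord.edist_le_max c d).trans_lt (max_lt hTc hTd)
    exact (setOfPred_coord_lt_subset hcd).antisymm
      (setOfPred_coord_lt_subset (edist_comm c d ▸ hcd))
  · rintro _ ⟨c, hc, rfl⟩ -
    exact disjoint_left.2 fun T hTa hTc =>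
      ((T.isKatetov_coord.le_max a c).trans (max_le (le_of_lt hTc) hc)).not_gt hTa

end Branches

section Components

variable {K : Type*} [DenselyNormedField K] [IsUltrametricDist K]
  [Infinite (IsLocalRing.ResidueField (NormedField.valuation (K := K)).valuationSubring)]

theorem ne_ofBall_iff {T : Ber K} {a : K} {r : ℝ≥0∞} :
    T ≠ ofBall a r ↔ r < T.coord a ∨ ∃ c, edist c a ≤ r ∧ T.coord c < r := by
  rw [← coord_injective.ne_iff, coord_ofBall, T.isKatetov_coord.ne_cone_iff]

theorem compl_ofBall_zero (x : K) : ({ofBall x 0}ᶜ : Set (Ber K)) = {T | 0 < T.coord x} := by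
  ext T
  simp [ne_ofBall_iff]

theorem compl_ofBall_top (x : K) : ({ofBall x ⊤}ᶜ : Set (Ber K)) = {T | T.coord x < ⊤} := by
  ext T
  rw [mem_compl_singleton_iff, ne_ofBall_iff, mem_ofPred_eq]
  refine ⟨?_, fun h => .inr ⟨x, le_top, h⟩⟩
  rintro (h | ⟨c, -, h⟩)
  · exact (not_top_lt h).elim
  · exact (T.isKatetov_coord.le_max x c).trans_lt (max_lt h (edist_lt_top c x))

theorem IsClassical.isConnected_compl {S : Ber K} (h : S.IsClassical) :
    IsConnected ({S}ᶜ : Set (Ber K)) := by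
  obtain ⟨p, hp⟩ := h.exists_coord_eq_edistTo
  obtain ⟨x, hx | hx⟩ := exists_edistTo_eq_cone p <;> rw [hx, ← coord_ofBall] at hp
  · rw [coord_injective hp, compl_ofBall_zero]
    exact isConnected_lt_coord x zero_lt_top
  · rw [coord_injective hp, compl_ofBall_top]
    exact isConnected_coord_lt x zero_lt_top

theorem IsSingular.isConnected_compl {S : Ber K} (h : S.IsSingular) :
    IsConnected ({S}ᶜ : Set (Ber K)) := by
  have hlt : ∀ a, ∃ c, S.coord c < S.coord a := fun a => by
    have ha : a ∉ S.core := h.2 ▸ notMem_empty a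
    simpa [mem_core_iff] using ha
  have hcompl : ({S}ᶜ : Set (Ber K)) =
      ⋃₀ {A | ∃ c r, S.coord c < r ∧ r < ⊤ ∧ A = {T : Ber K | r < T.coord c}} := by
    ext T
    constructor
    · intro hT
      obtain ⟨c, hc⟩ : ∃ c, S.coord c < T.coord c := by
        by_contra! hle
        exact hT (coord_injective (S.isKatetov_coord.eq_of_le T.isKatetov_coord hle hlt))
      obtain ⟨r, hr, hrT⟩ := exists_between hc
      exact ⟨_, ⟨c, r, hr, hrT.trans_le le_top, rfl⟩, hrT⟩
    · rintro ⟨_, ⟨c, r, hr, -, rfl⟩, hT⟩ rfl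
      exact lt_asymm hr hT
  obtain ⟨c, hc⟩ := hlt 0
  have hinfty : ofBall (0 : K) ⊤ ≠ S := by
    rintro rfl
    simp [coord_ofBall, cone_top] at hc
  refine ⟨⟨_, hinfty⟩, hcompl ▸ isPreconnected_sUnion (ofBall 0 ⊤) _ ?_ ?_⟩
  · rintro _ ⟨c, r, -, hr, rfl⟩
    simpa [coord_ofBall, cone_top] using hr
  · rintro _ ⟨c, r, -, hr, rfl⟩
    exact (isConnected_lt_coord c hr).isPreconnected

theorem isConnected_of_mem_branches {a : K} {r : ℝ≥0∞} (hr : 0 < r) (hr' : r < ⊤)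
    {A : Set (Ber K)} (hA : A ∈ branches a r) : IsConnected A := by
  obtain rfl | ⟨c, -, rfl⟩ := hA
  exacts [isConnected_lt_coord a hr', isConnected_coord_lt c hr]

theorem sUnion_branches (a : K) (r : ℝ≥0∞) : ⋃₀ branches a r = {ofBall a r}ᶜ := by
  ext T
  rw [mem_compl_singleton_iff, ne_ofBall_iff]
  simp only [branches, sUnion_insert, mem_union, mem_ofPred_eq, mem_sUnion]
  exact or_congr_right ⟨fun ⟨_, ⟨c, hc, h⟩, hT⟩ => ⟨c, hc, h.subset hT⟩,
    fun ⟨c, hc, hT⟩ => ⟨_, ⟨c, hc, rfl⟩, hT⟩⟩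

theorem setOfPred_connectedComponentIn_compl_ofBall (a : K) {r : ℝ≥0∞} (hr : 0 < r) (hr' : r < ⊤) :
    {A | ∃ T ∈ ({ofBall a r}ᶜ : Set (Ber K)), A = connectedComponentIn {ofBall a r}ᶜ T} =
      branches a r :=
  setOfPred_connectedComponentIn_eq (sUnion_branches a r) (fun _ => isOpen_of_mem_branches)
    (fun _ => isConnected_of_mem_branches hr hr') (pairwiseDisjoint_branches a r)

theorem setOfPred_hat_directions_eq_branches {S : Ber K} (hS : S.IsRational ∨ S.IsIrrational)
    {a : K} {r : ℝ} (hr : 0 < r) (h : S.core = Metric.closedBall a r) :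
    {A | ∃ B ∈ S.directions, A = hat B} = branches a (ENNReal.ofReal r) := by
  ext A
  simp only [mem_ofPred_eq, mem_directions_iff hS hr h, branches, mem_insert_iff,
    edist_le_ofReal hr.le]
  constructor
  · rintro ⟨_, ⟨c, hc, rfl⟩ | rfl, rfl⟩
    exacts [.inr ⟨c, hc, hat_image_ball c hr⟩, .inl (hat_compl_image_closedBall a hr)]
  · rintro (rfl | ⟨c, hc, rfl⟩)
    exacts [⟨_, .inr rfl, (hat_compl_image_closedBall a hr).symm⟩,
      ⟨_, .inl ⟨c, hc, rfl⟩, (hat_image_ball c hr).symm⟩]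

theorem setOfPred_connectedComponentIn_compl_eq {S : Ber K}
    (hS : S.IsRational ∨ S.IsIrrational) :
    {A : Set (Ber K) | ∃ T ∈ ({S}ᶜ : Set (Ber K)), A = connectedComponentIn {S}ᶜ T} =
      {A | ∃ B ∈ S.directions, A = hat B} := by
  obtain ⟨a, r, hr, hcore⟩ := exists_core_eq_closedBall hS
  rw [setOfPred_hat_directions_eq_branches hS hr hcore, eq_ofBall_of_core_eq hr.le hcore]
  exact setOfPred_connectedComponentIn_compl_ofBall a (ofReal_pos.2 hr) ofReal_lt_top

end Components

end Ber

end BerkovichLine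

theorem mainTheorem9_general {K : Type*} [NormedField K] [IsUltrametricDist K]
    (hres : Infinite (IsLocalRing.ResidueField (NormedField.valuation (K := K)).valuationSubring))
    (hval : ¬ DiscreteTopology (BerkovichLine.valueGroup K))
    (S : BerkovichLine.Ber K) :
    ((S.IsRational ∨ S.IsIrrational) →
      {A : Set (BerkovichLine.Ber K) | ∃ T ∈ ({S}ᶜ : Set (BerkovichLine.Ber K)),
          A = connectedComponentIn {S}ᶜ T} =
        {A | ∃ B ∈ S.directions, A = BerkovichLine.Ber.hat B}) ∧
    ((S.IsSingular ∨ S.IsClassical) → IsConnected ({S}ᶜ : Set (BerkovichLine.Ber K))) := by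
  let := BerkovichLine.denselyNormedFieldOfNotDiscrete hval
  exact ⟨BerkovichLine.Ber.setOfPred_connectedComponentIn_compl_eq, fun h =>
    h.elim BerkovichLine.Ber.IsSingular.isConnected_compl
      BerkovichLine.Ber.IsClassical.isConnected_compl⟩

theorem mainTheorem9 {K : Type*} [NormedField K] [IsUltrametricDist K] [CompleteSpace K]
    (hres : Infinite (IsLocalRing.ResidueField (NormedField.valuation (K := K)).valuationSubring))
    (hval : ¬ DiscreteTopology (BerkovichLine.valueGroup K))
    (S : BerkovichLine.Ber K) :
    ((S.IsRational ∨ S.IsIrrational) →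
      {A : Set (BerkovichLine.Ber K) | ∃ T ∈ ({S}ᶜ : Set (BerkovichLine.Ber K)),
          A = connectedComponentIn {S}ᶜ T} =
        {A | ∃ B ∈ S.directions, A = BerkovichLine.Ber.hat B}) ∧
    ((S.IsSingular ∨ S.IsClassical) → IsConnected ({S}ᶜ : Set (BerkovichLine.Ber K))) :=
  mainTheorem9_general hres hval S
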